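/- Let $(X,\mathcal X,\mu)$ be a probability space and let $(P_t)_{t\ge 0}$ be a symmetric Markov semigroup on $L^2(\mu)$ with reversible measure $\mu$, that is, a strongly continuous semigroup of bounded symmetric operators on the real space $L^2(\mu)$ which preserve positivity and satisfy $P_t 1=1$. Let $L$ be its generator, with domain $\mathcal D(L)$, and let $$\mathcal E(f,f)=\lim_{t\to 0^+}\frac1t\int_X f\,(f-P_tf)\,d\mu$$ be its Dirichlet form, whose domain $\mathcal D(\mathcal E)$ is the set of $f\in L^2(\mu)$ for which this limit exists and is finite; thus $\mathcal D(L)\subset\mathcal D(\mathcal E)$ and $\mathcal E(f,f)=-\int_X f\,Lf\,d\mu$ for $f\in\mathcal D(L)$. Assume that $L$ satisfies a Poincaré inequality: for some constant $c>0$, $$\int_X f^2\,d\mu-\Big(\int_X f\,d\mu\Big)^2\le -c\int_X f\,Lf\,d\mu\qquad\text{for all } f\in\mathcal D(L).$$ Assume moreover that there is an orthogonal Hilbert space decomposition $L^2(\mu)=\bigoplus_{k=0}^\infty H_k$ into linear subspaces such that, for some real numbers $a>0$, $C$ and $p$, $$\|P_tf\|_\infty\le C\,\max(k,1)^p\,e^{-atk^2}\,\|f\|_2\qquad\text{for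 all } k\ge 0,\ f\in H_k,\ t>0.$$ (For $k\ge1$ the prefactor is $Ck^p$; for $k=0$ the bound reads $\|P_tf\|_\infty\le C\|f\|_2$, which holds with any $C\ge1$ when $H_0$ is the space of constant functions.) Then $L$ satisfies a tight Sobolev inequality with dimension $m$ for every real $m>2$ with $m\ge 2p+1$: there is a constant $C'>0$ such that $$\|f\|_{2m/(m-2)}^2\le \|f\|_2^2+C'\,\mathcal E(f,f)\qquad\text{for all } f\in\mathcal D(\mathcal E).$$ In particular this holds with $m=2p+1$ if $p>1/2$, and with $m=2(p+1)$ if $p>0$. -/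

import Mathlib

open MeasureTheory ProbabilityTheory Filter Topology
open scoped ENNReal

/-- A symmetric Markov semigroup `(P_t)_{t ≥ 0}` with reversible probability measure `μ`, acting on
the real space `L²(μ)`: a strongly continuous semigroup of bounded operators which are symmetric
in `L²(μ)` (reversibility), preserve positivity and fix the constant function `1`.
The operators at negative times are not constrained and are never used. -/
structure SymmetricMarkovSemigroup {X : Type*} [MeasurableSpace X] (μ : Measure X)
    [IsProbabilityMeasure μ] where
  /-- the operator `P_t` -/
  op : ℝ → (Lp ℝ 2 μ →L[ℝ] Lp ℝ 2 μ)
  op_zero : ∀ f, op 0 f = f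
  op_add : ∀ s t, 0 ≤ s → 0 ≤ t → ∀ f, op (s + t) f = op s (op t f)
  continuous_at_zero : ∀ f, Tendsto (fun t => op t f) (𝓝[>] 0) (𝓝 f)
  symm : ∀ t, 0 ≤ t → ∀ f g, inner ℝ (op t f) g = inner ℝ f (op t g)
  positive : ∀ t, 0 ≤ t → ∀ f, 0 ≤ f → 0 ≤ op t f
  map_one : ∀ t, 0 ≤ t → op t (Lp.const 2 μ (1 : ℝ)) = Lp.const 2 μ (1 : ℝ)

namespace SymmetricMarkovSemigroup

variable {X : Type*} [MeasurableSpace X] {μ : Measure X} [IsProbabilityMeasure μ]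

/-- The graph of the infinitesimal generator `L`: `P.HasGenerator f g` says that `f` is in the
domain of `L` and `L f = g`, that is, `(P_t f - f) / t → g` in `L²(μ)` as `t → 0⁺`. -/
def HasGenerator (P : SymmetricMarkovSemigroup μ) (f g : Lp ℝ 2 μ) : Prop :=
  Tendsto (fun t : ℝ => t⁻¹ • (P.op t f - f)) (𝓝[>] 0) (𝓝 g)

/-- The Dirichlet form: `P.HasEnergy f e` says that `f` is in the domain of the Dirichlet form and
`ℰ(f, f) = e`, that is, `(1/t) ∫ f (f - P_t f) dμ → e` as `t → 0⁺`. -/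
def HasEnergy (P : SymmetricMarkovSemigroup μ) (f : Lp ℝ 2 μ) (e : ℝ) : Prop :=
  Tendsto (fun t : ℝ => t⁻¹ * inner ℝ f (f - P.op t f)) (𝓝[>] 0) (𝓝 e)

/-- On the domain of the generator, `ℰ(f, f) = - ∫ f L f dμ` (`= ∫ Γ(f, f) dμ`). -/
theorem HasGenerator.hasEnergy {P : SymmetricMarkovSemigroup μ} {f g : Lp ℝ 2 μ}
    (h : P.HasGenerator f g) : P.HasEnergy f (-inner ℝ f g) := by
  have h1 : Tendsto (fun t : ℝ => -inner ℝ f (t⁻¹ • (P.op t f - f))) (𝓝[>] 0)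
      (𝓝 (-inner ℝ f g)) := (Tendsto.inner tendsto_const_nhds h).neg
  refine h1.congr fun t => ?_
  rw [inner_smul_right, ← neg_sub f, inner_neg_right]
  ring

/-- The generator satisfies a Poincaré inequality (spectral gap):
`Var_μ(f) ≤ c ∫ f (-L f) dμ` for all `f` in the domain of `L`. -/
def SatisfiesPoincare (P : SymmetricMarkovSemigroup μ) : Prop :=
  ∃ c : ℝ, 0 < c ∧ ∀ f g : Lp ℝ 2 μ, P.HasGenerator f g →
    variance (f : X → ℝ) μ ≤ c * (-inner ℝ f g)

/-- The `n`-dimensional Sobolev inequality with constants `A` and `C`: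
`‖f‖²_{2n/(n-2)} ≤ A ‖f‖₂² + C ℰ(f, f)` for all `f` in the domain of the Dirichlet form
(in particular such `f` are in `L^{2n/(n-2)}(μ)`). It is meant for `n > 2`. -/
def SobolevInequality (P : SymmetricMarkovSemigroup μ) (n A C : ℝ) : Prop :=
  ∀ (f : Lp ℝ 2 μ) (e : ℝ), P.HasEnergy f e →
    eLpNorm (f : X → ℝ) (ENNReal.ofReal (2 * n / (n - 2))) μ ^ 2 ≤
      ENNReal.ofReal (A * ‖f‖ ^ 2 + C * e)

/-- A tight `n`-dimensional Sobolev inequality: the constant in front of `‖f‖₂²` is `1`. -/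
def SatisfiesTightSobolev (P : SymmetricMarkovSemigroup μ) (n : ℝ) : Prop :=
  2 < n ∧ ∃ C : ℝ, 0 < C ∧ P.SobolevInequality n 1 C

end SymmetricMarkovSemigroup

/-! The bounds on the summands give ultracontractivity, which gives a Sobolev inequality with some
constant in front of `‖f‖₂²`; the spectral gap then makes it tight.

Ultracontractivity (`exists_norm_op_sq_le`): decompose `P_t g = ∑ w_k` with `w_k ∈ H_k`. By symmetry
`‖P_t g‖₂² = ∑ ⟨P_t w_k, g⟩`, and each term is at most `‖P_t w_k‖_∞ ‖g‖₁`. Cauchy–Schwarz in `k`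
leaves a sum of `k^{m-1} e^{-2atk²}`, of order at most `t^{-m/2}`; hence `‖P_t‖_{1→2}² ≤ K t^{-m/2}`
for `t ≤ 1`. The `H_k` need not be invariant under `P_t`.

Sobolev (`exists_eLpNorm_sq_le`): the identity `‖g‖² = t ℰ_t(g) + ‖P_{t/2} g‖²`, where `ℰ_t(g) =
t⁻¹⟨g, g - P_t g⟩`, turns this into a Nash-type bound with a free time `t`. It is applied to the
slices of `f ≥ 0` between the levels `l 2^j` and `l 2^{j+1}`, with `t` tuned to the measure of the
level set. The energies of the slices add up to at most that of `f`, and the resulting recursion for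
the weighted level-set measures is summed by absorption.

Tightening (`exists_eLpNorm_const_add_sq_le`): the linear term of `|1 + u|^q` integrates to zero for
centred `u`, so `‖b + g‖_q² ≤ b² + B ‖g‖_q²` with `b` the mean of `f` and `g = f - b`. The Poincaré
inequality absorbs `‖g‖₂²` into the energy, and `b² ≤ ‖f‖₂²`.

Working with `ℰ_t` for fixed `t` avoids showing that truncations stay in the domain of the Dirichlet
form. -/

/-- A function on `[0, ∞)` which is bounded above and satisfies the midpoint convexity inequality
at all pairs `(0, 2s)` is bounded above by its value at `0`. -/
theorem le_apply_zero_of_two_mul_le {ψ : ℝ → ℝ} {M : ℝ} (hM : ∀ s, 0 ≤ s → ψ s ≤ M)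
    (hψ : ∀ s, 0 < s → 2 * ψ s ≤ ψ 0 + ψ (2 * s)) {t : ℝ} (ht : 0 ≤ t) : ψ t ≤ ψ 0 := by
  have hbdd : BddAbove (ψ '' Set.Ici 0) := ⟨M, by rintro _ ⟨s, hs, rfl⟩; exact hM s hs⟩
  have hle : ∀ s, 0 ≤ s → ψ s ≤ sSup (ψ '' Set.Ici 0) := fun s hs =>
    le_csSup hbdd (Set.mem_image_of_mem ψ hs)
  have hS : sSup (ψ '' Set.Ici 0) ≤ (ψ 0 + sSup (ψ '' Set.Ici 0)) / 2 := by
    refine csSup_le (Set.image_nonempty.2 Set.nonempty_Ici) ?_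
    rintro _ ⟨s, hs, rfl⟩
    rcases (Set.mem_Ici.1 hs).eq_or_lt with rfl | hs0
    · linarith [hle 0 le_rfl]
    · linarith [hψ s hs0, hle (2 * s) (by positivity)]
  linarith [hle t ht]

/-! ### Order and inner product in `L²` -/

section LpTwo

variable {X : Type*} [MeasurableSpace X] {μ : Measure X}

theorem L2.inner_eq_integral_mul (f g : Lp ℝ 2 μ) : inner ℝ f g = ∫ x, f x * g x ∂μ := by
  rw [L2.inner_def]
  simp [mul_comm]

theorem L2.inner_nonneg {f g : Lp ℝ 2 μ} (hf : 0 ≤ f) (hg : 0 ≤ g) : 0 ≤ inner ℝ f g := by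
  rw [L2.inner_eq_integral_mul]
  refine integral_nonneg_of_ae ?_
  filter_upwards [(Lp.coeFn_nonneg f).2 hf, (Lp.coeFn_nonneg g).2 hg] with x h1 h2
  exact mul_nonneg h1 h2

theorem L2.inner_le_inner_of_le_left {f g h : Lp ℝ 2 μ} (hfg : f ≤ g) (hh : 0 ≤ h) :
    inner ℝ f h ≤ inner ℝ g h := by
  have := L2.inner_nonneg (sub_nonneg.2 hfg) hh
  rw [inner_sub_left] at this
  linarith

theorem L2.inner_le_inner_of_le_right {f g h : Lp ℝ 2 μ} (hfg : f ≤ g) (hh : 0 ≤ h) :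
    inner ℝ h f ≤ inner ℝ h g := by
  rw [real_inner_comm, real_inner_comm g]
  exact L2.inner_le_inner_of_le_left hfg hh

theorem L2.inner_le_inner_abs (f g : Lp ℝ 2 μ) : inner ℝ f g ≤ inner ℝ |f| |g| := by
  have h1 := L2.inner_nonneg (sub_nonneg.2 (le_abs_self f)) (sub_nonneg.2 (neg_le_abs g))
  have h2 := L2.inner_nonneg (neg_le_iff_add_nonneg'.1 (neg_le_abs f)) (sub_nonneg.2 (le_abs_self g))
  simp only [inner_sub_left, inner_sub_right, inner_add_left, inner_neg_right] at h1 h2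
  linarith

variable [IsProbabilityMeasure μ]

theorem Lp.const_mono {c d : ℝ} (h : c ≤ d) : Lp.const 2 μ c ≤ Lp.const 2 μ d := by
  rw [← Lp.coeFn_le]
  filter_upwards [Lp.coeFn_const (μ := μ) 2 c, Lp.coeFn_const (μ := μ) 2 d] with x h1 h2
  rw [h1, h2]
  exact h

theorem Lp.const_eq_smul_one (c : ℝ) : Lp.const 2 μ c = c • Lp.const 2 μ (1 : ℝ) := by
  refine Lp.ext ?_
  filter_upwards [Lp.coeFn_smul c (Lp.const 2 μ (1 : ℝ))] with x h
  simp [h]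

theorem L2.inner_const (f : Lp ℝ 2 μ) (c : ℝ) :
    inner ℝ f (Lp.const 2 μ c) = c * ∫ x, f x ∂μ := by
  rw [L2.inner_eq_integral_mul, ← integral_const_mul]
  simp [mul_comm]

end LpTwo

/-! ### Contractivity and approximate Dirichlet forms -/

namespace SymmetricMarkovSemigroup

variable {X : Type*} [MeasurableSpace X] {μ : Measure X} [IsProbabilityMeasure μ]
  (P : SymmetricMarkovSemigroup μ)

theorem op_mono {t : ℝ} (ht : 0 ≤ t) {f g : Lp ℝ 2 μ} (h : f ≤ g) : P.op t f ≤ P.op t g := by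
  have := P.positive t ht (g - f) (sub_nonneg.2 h)
  rwa [map_sub, sub_nonneg] at this

theorem op_const {t : ℝ} (ht : 0 ≤ t) (c : ℝ) : P.op t (Lp.const 2 μ c) = Lp.const 2 μ c := by
  rw [Lp.const_eq_smul_one, map_smul, P.map_one t ht]

theorem abs_op_le {t : ℝ} (ht : 0 ≤ t) (f : Lp ℝ 2 μ) : |P.op t f| ≤ P.op t |f| := by
  refine abs_le'.2 ⟨P.op_mono ht (le_abs_self f), ?_⟩
  rw [← map_neg]
  exact P.op_mono ht (neg_le_abs f)

theorem inner_op_two_mul {t : ℝ} (ht : 0 ≤ t) (f : Lp ℝ 2 μ) :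
    inner ℝ f (P.op (t + t) f) = ‖P.op t f‖ ^ 2 := by
  rw [P.op_add t t ht ht, ← P.symm t ht, real_inner_self_eq_norm_sq]

/-- Contractivity is not an axiom of the semigroup. For bounded `f`, positivity and `P_t 1 = 1` keep
`s ↦ ⟨f, P_s f⟩ = ‖P_{s/2} f‖²` bounded, and Cauchy–Schwarz makes it midpoint convex at `(0, 2s)`;
so it never exceeds its value at `0`. -/
theorem norm_op_le_of_bounded {f : Lp ℝ 2 μ} {M : ℝ} (hf : |f| ≤ Lp.const 2 μ M) {t : ℝ}
    (ht : 0 ≤ t) : ‖P.op t f‖ ≤ ‖f‖ := by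
  have hb : ∀ s, 0 ≤ s → ‖P.op s f‖ ≤ ‖Lp.const 2 μ M‖ := fun s hs => by
    refine norm_le_norm_of_abs_le_abs ((P.abs_op_le hs f).trans ?_)
    refine (P.op_mono hs hf).trans ?_
    rw [P.op_const hs]
    exact le_abs_self _
  have key := le_apply_zero_of_two_mul_le (ψ := fun s => ‖P.op (s / 2) f‖ ^ 2)
    (M := ‖Lp.const 2 μ M‖ ^ 2) (fun s hs => by gcongr; exact hb _ (by positivity))
    (fun s hs => ?_) (t := t + t) (by positivity)
  · simp only [add_self_div_two, zero_div, P.op_zero] at key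
    exact le_of_sq_le_sq key (norm_nonneg f)
  · have h2 : 2 * s / 2 = s := by ring
    have h := real_inner_le_norm f (P.op s f)
    have h3 := P.inner_op_two_mul (half_pos hs).le f
    rw [add_halves] at h3
    rw [zero_div, h2, P.op_zero, ← h3]
    nlinarith [sq_nonneg (‖f‖ - ‖P.op s f‖)]

theorem norm_op_le {t : ℝ} (ht : 0 ≤ t) (f : Lp ℝ 2 μ) : ‖P.op t f‖ ≤ ‖f‖ := by
  refine (Lp.simpleFunc.denseRange (E := ℝ) (μ := μ) (p := 2) (by simp)).induction_on
    (p := fun f => ‖P.op t f‖ ≤ ‖f‖) f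
    (isClosed_le (by fun_prop) (by fun_prop)) fun g => ?_
  obtain ⟨M, hM⟩ := (Lp.simpleFunc.toSimpleFunc g).exists_forall_norm_le
  refine P.norm_op_le_of_bounded (M := M) ?_ ht
  rw [← Lp.coeFn_le]
  filter_upwards [Lp.coeFn_abs (g : Lp ℝ 2 μ), Lp.simpleFunc.toSimpleFunc_eq_toFun g,
    Lp.coeFn_const (μ := μ) 2 M] with x h1 h2 h3
  rw [h1, h3, ← h2]
  exact hM x

theorem inner_op_le {t : ℝ} (ht : 0 ≤ t) (f : Lp ℝ 2 μ) : inner ℝ f (P.op t f) ≤ ‖f‖ ^ 2 := by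
  refine (real_inner_le_norm _ _).trans ?_
  rw [sq]
  gcongr
  exact P.norm_op_le ht f

/-- The approximate Dirichlet form `(1/t) ∫ f (f - P_t f) dμ`. -/
noncomputable def approxEnergy (t : ℝ) (f : Lp ℝ 2 μ) : ℝ :=
  t⁻¹ * inner ℝ f (f - P.op t f)

theorem mul_approxEnergy {t : ℝ} (ht : 0 < t) (f : Lp ℝ 2 μ) :
    t * P.approxEnergy t f = ‖f‖ ^ 2 - inner ℝ f (P.op t f) := by
  rw [approxEnergy, mul_inv_cancel_left₀ ht.ne', inner_sub_right, real_inner_self_eq_norm_sq]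

theorem approxEnergy_nonneg {t : ℝ} (ht : 0 < t) (f : Lp ℝ 2 μ) : 0 ≤ P.approxEnergy t f := by
  have h := P.mul_approxEnergy ht f
  have := P.inner_op_le ht.le f
  exact nonneg_of_mul_nonneg_right (by linarith) ht

theorem inner_op_le_half_add {s t : ℝ} (hs : 0 ≤ s) (ht : 0 ≤ t) (f : Lp ℝ 2 μ) :
    2 * inner ℝ f (P.op (s + t) f) ≤
      inner ℝ f (P.op (s + s) f) + inner ℝ f (P.op (t + t) f) := by
  rw [P.inner_op_two_mul hs, P.inner_op_two_mul ht, P.op_add s t hs ht, ← P.symm s hs]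
  have := real_inner_le_norm (P.op s f) (P.op t f)
  nlinarith [sq_nonneg (‖P.op s f‖ - ‖P.op t f‖)]

/-- Midpoint convexity of `s ↦ ⟨f, P_s f⟩` at `0` and `t`. Monotonicity along halvings is all that
is needed to compare with the limit and to align dyadic times. -/
theorem approxEnergy_le_half {t : ℝ} (ht : 0 < t) (f : Lp ℝ 2 μ) :
    P.approxEnergy t f ≤ P.approxEnergy (t / 2) f := by
  have h := P.inner_op_le_half_add le_rfl (half_pos ht).le f
  rw [zero_add, zero_add, add_halves, P.op_zero, real_inner_self_eq_norm_sq] at h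
  have h1 := P.mul_approxEnergy ht f
  have h2 := P.mul_approxEnergy (half_pos ht) f
  refine le_of_mul_le_mul_left ?_ ht
  linarith

theorem approxEnergy_le_div_pow {t : ℝ} (ht : 0 < t) (f : Lp ℝ 2 μ) :
    Monotone fun n : ℕ => P.approxEnergy (t / 2 ^ n) f := by
  refine monotone_nat_of_le_succ fun n => ?_
  rw [pow_succ, ← div_div]
  exact P.approxEnergy_le_half (by positivity) f

variable {P} in
theorem HasEnergy.approxEnergy_le {f : Lp ℝ 2 μ} {e : ℝ} (h : P.HasEnergy f e) {t : ℝ}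
    (ht : 0 < t) : P.approxEnergy t f ≤ e := by
  have hlim : Tendsto (fun n : ℕ => t / 2 ^ n) atTop (𝓝[>] 0) := by
    refine tendsto_nhdsWithin_iff.2 ⟨?_, Eventually.of_forall fun n => ?_⟩
    · simpa [div_eq_mul_inv] using (tendsto_pow_atTop_nhds_zero_of_lt_one (r := (2 : ℝ)⁻¹)
        (by norm_num) (by norm_num)).const_mul t
    · exact Set.mem_Ioi.2 (by positivity)
  have := (P.approxEnergy_le_div_pow ht f).ge_of_tendsto (h.comp hlim) 0
  simpa using this

variable {P} in
theorem HasEnergy.nonneg {f : Lp ℝ 2 μ} {e : ℝ} (h : P.HasEnergy f e) : 0 ≤ e :=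
  (P.approxEnergy_nonneg one_pos f).trans (h.approxEnergy_le one_pos)

theorem approxEnergy_abs_le {t : ℝ} (ht : 0 < t) (f : Lp ℝ 2 μ) :
    P.approxEnergy t |f| ≤ P.approxEnergy t f := by
  have h1 := P.mul_approxEnergy ht f
  have h2 := P.mul_approxEnergy ht |f|
  rw [norm_abs_eq_norm] at h2
  have h3 := (L2.inner_le_inner_abs f (P.op t f)).trans
    (L2.inner_le_inner_of_le_right (P.abs_op_le ht.le f) (abs_nonneg f))
  refine le_of_mul_le_mul_left ?_ ht
  linarith

theorem approxEnergy_smul (t c : ℝ) (f : Lp ℝ 2 μ) :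
    P.approxEnergy t (c • f) = c ^ 2 * P.approxEnergy t f := by
  simp only [approxEnergy, map_smul, ← smul_sub, inner_smul_left, inner_smul_right]
  simp; ring

theorem approxEnergy_sub_const {t : ℝ} (ht : 0 ≤ t) (c : ℝ) (f : Lp ℝ 2 μ) :
    P.approxEnergy t (f - Lp.const 2 μ c) = P.approxEnergy t f := by
  simp only [approxEnergy, map_sub, inner_sub_left, inner_sub_right, ← P.symm t ht, P.op_const ht]
  ring

/-- The cross term is nonnegative: `⟨u, P_t h⟩ ≤ ⟨c, P_t h⟩ = ⟨c, h⟩ = ⟨u, h⟩`. In the applications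
`u` equals its upper bound `c` wherever `h` is nonzero. -/
theorem approxEnergy_add_le {t : ℝ} (ht : 0 < t) {u h : Lp ℝ 2 μ} {c : ℝ}
    (hu : u ≤ Lp.const 2 μ c) (hh : 0 ≤ h)
    (huh : inner ℝ u h = inner ℝ (Lp.const 2 μ c) h) :
    P.approxEnergy t u + P.approxEnergy t h ≤ P.approxEnergy t (u + h) := by
  have h1 : inner ℝ u (P.op t h) ≤ inner ℝ u h := by
    refine (L2.inner_le_inner_of_le_left hu (P.positive t ht.le h hh)).trans ?_
    rw [← P.symm t ht.le, P.op_const ht.le, huh]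
  have h2 : inner ℝ h (P.op t u) = inner ℝ u (P.op t h) := by
    rw [real_inner_comm, P.symm t ht.le]
  have h3 : inner ℝ h u = inner ℝ u h := real_inner_comm _ _
  have key : P.approxEnergy t (u + h) = P.approxEnergy t u + P.approxEnergy t h +
      t⁻¹ * (2 * (inner ℝ u h - inner ℝ u (P.op t h))) := by
    simp only [approxEnergy, map_add, inner_sub_right, inner_add_right, inner_add_left, h2, h3]
    ring
  rw [key]
  have : 0 ≤ t⁻¹ * (2 * (inner ℝ u h - inner ℝ u (P.op t h))) :=
    mul_nonneg (by positivity) (by linarith)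
  linarith

end SymmetricMarkovSemigroup

/-! ### Poincaré inequality on the domain of the Dirichlet form -/

theorem variance_Lp_eq {X : Type*} [MeasurableSpace X] {μ : Measure X} [IsProbabilityMeasure μ]
    (f : Lp ℝ 2 μ) : variance (f : X → ℝ) μ = ‖f‖ ^ 2 - (∫ x, f x ∂μ) ^ 2 := by
  rw [variance_eq_sub (Lp.memLp f), ← real_inner_self_eq_norm_sq, L2.inner_eq_integral_mul]
  simp [sq]

namespace SymmetricMarkovSemigroup

variable {X : Type*} [MeasurableSpace X] {μ : Measure X} [IsProbabilityMeasure μ]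
  (P : SymmetricMarkovSemigroup μ)

theorem norm_op_sub_op_le {s t : ℝ} (hs : 0 ≤ s) (hst : s ≤ t) (f : Lp ℝ 2 μ) :
    ‖P.op t f - P.op s f‖ ≤ ‖P.op (t - s) f - f‖ := by
  have : P.op t f = P.op s (P.op (t - s) f) := by
    rw [← P.op_add s (t - s) hs (sub_nonneg.2 hst), add_sub_cancel]
  rw [this, ← map_sub]
  exact P.norm_op_le hs _

/-- The absolute value removes the unconstrained negative times, so that integrals and derivatives
at `0` can be taken on the whole line. -/
theorem continuous_op_abs (f : Lp ℝ 2 μ) : Continuous fun t : ℝ => P.op |t| f := by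
  rw [Metric.continuous_iff]
  intro b ε hε
  obtain ⟨δ, hδ, h⟩ := Metric.tendsto_nhdsWithin_nhds.1 (P.continuous_at_zero f) ε hε
  have key : ∀ r, 0 ≤ r → r < δ → ‖P.op r f - f‖ < ε := fun r hr hrδ => by
    rcases hr.eq_or_lt with rfl | hr0
    · simpa [P.op_zero] using hε
    · simpa [dist_eq_norm] using h hr0 (by simpa [abs_of_pos hr0] using hrδ)
  refine ⟨δ, hδ, fun a hab => ?_⟩
  have hd : |(|a| - |b|)| < δ := (abs_abs_sub_abs_le _ _).trans_lt (by simpa [Real.dist_eq] using hab)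
  rw [abs_lt] at hd
  rcases le_total |b| |a| with h1 | h1
  · rw [dist_eq_norm]
    exact (P.norm_op_sub_op_le (abs_nonneg b) h1 f).trans_lt
      (key _ (sub_nonneg.2 h1) (by linarith))
  · rw [dist_comm, dist_eq_norm]
    exact (P.norm_op_sub_op_le (abs_nonneg a) h1 f).trans_lt
      (key _ (sub_nonneg.2 h1) (by linarith))

/-- The left side is bounded in `s`, and it is midpoint convex at `(0, 2r)` because `f - P_r f` has
nonnegative approximate energy; so its value at `s = 0` dominates. -/
theorem inner_op_sub_op_le {s h : ℝ} (hs : 0 ≤ s) (hh : 0 < h) (f : Lp ℝ 2 μ) :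
    inner ℝ (P.op s f) (f - P.op h f) ≤ h * P.approxEnergy h f := by
  have h0 : h * P.approxEnergy h f = inner ℝ (P.op 0 f) (f - P.op h f) := by
    rw [P.op_zero, approxEnergy, mul_inv_cancel_left₀ hh.ne']
  rw [h0]
  refine le_apply_zero_of_two_mul_le (ψ := fun s => inner ℝ (P.op s f) (f - P.op h f))
    (M := ‖f‖ * ‖f - P.op h f‖) (fun r hr => ?_) (fun r hr => ?_) hs
  · refine (real_inner_le_norm _ _).trans ?_
    gcongr
    exact P.norm_op_le hr f
  · have h1 := mul_nonneg hh.le (P.approxEnergy_nonneg hh (f - P.op r f))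
    rw [approxEnergy, mul_inv_cancel_left₀ hh.ne'] at h1
    have h2 : P.op h (P.op r f) = P.op r (P.op h f) := by
      rw [← P.op_add h r hh.le hr.le, ← P.op_add r h hr.le hh.le, add_comm]
    have h3 : P.op (2 * r) f = P.op r (P.op r f) := by
      rw [← P.op_add r r hr.le hr.le, two_mul]
    rw [h3, P.op_zero]
    simp only [map_sub, inner_sub_left, inner_sub_right, h2] at h1 ⊢
    have h4 : inner ℝ f (P.op r f) = inner ℝ (P.op r f) f := real_inner_comm _ _
    simp only [P.symm r hr.le] at h1 h4 ⊢
    linarith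

theorem hasGenerator_integral {h : ℝ} (hh : 0 ≤ h) (f : Lp ℝ 2 μ) :
    P.HasGenerator (∫ s in (0 : ℝ)..h, P.op |s| f) (P.op h f - f) := by
  have hc := P.continuous_op_abs f
  have hd : ∀ b, HasDerivAt (fun y => ∫ s in (0 : ℝ)..y, P.op |s| f) (P.op |b| f) b := fun b =>
    intervalIntegral.integral_hasDerivAt_right (hc.intervalIntegrable _ _)
      hc.stronglyMeasurable.stronglyMeasurableAtFilter hc.continuousAt
  have h1 := (hasDerivAt_iff_tendsto_slope_zero.1 (hd h)).mono_left
    (nhdsWithin_mono 0 fun x (hx : x ∈ Set.Ioi 0) => ne_of_gt hx)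
  have h2 := (hasDerivAt_iff_tendsto_slope_zero.1 (hd 0)).mono_left
    (nhdsWithin_mono 0 fun x (hx : x ∈ Set.Ioi 0) => ne_of_gt hx)
  have h3 := h1.sub h2
  rw [abs_zero, P.op_zero, abs_of_nonneg hh] at h3
  refine h3.congr' ?_
  filter_upwards [self_mem_nhdsWithin] with t (ht : 0 < t)
  rw [← smul_sub]
  congr 1
  have h4 : P.op t (∫ s in (0 : ℝ)..h, P.op |s| f) = ∫ s in t..(h + t), P.op |s| f := by
    rw [← ContinuousLinearMap.intervalIntegral_comp_comm _ (hc.intervalIntegrable _ _)]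
    have h5 := intervalIntegral.integral_comp_add_right (a := 0) (b := h) (fun s => P.op |s| f) t
    rw [zero_add] at h5
    rw [← h5]
    refine intervalIntegral.integral_congr fun s hs => ?_
    rw [Set.uIcc_of_le hh] at hs
    rw [abs_of_nonneg hs.1, abs_of_nonneg (add_nonneg hs.1 ht.le), add_comm,
      P.op_add t s ht.le hs.1]
  rw [h4, ← intervalIntegral.integral_interval_sub_left (hc.intervalIntegrable 0 (h + t))
    (hc.intervalIntegrable 0 t)]
  simp
  abel

/-- A Poincaré inequality on the domain of the generator extends to the domain of the Dirichlet
form. -/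
theorem variance_le_of_hasEnergy {c : ℝ} (hc : 0 < c)
    (hP : ∀ f g : Lp ℝ 2 μ, P.HasGenerator f g → variance (f : X → ℝ) μ ≤ c * (-inner ℝ f g))
    {f : Lp ℝ 2 μ} {e : ℝ} (he : P.HasEnergy f e) : variance (f : X → ℝ) μ ≤ c * e := by
  have hcont := P.continuous_op_abs f
  have hd : HasDerivAt (fun y => ∫ s in (0 : ℝ)..y, P.op |s| f) (P.op |0| f) 0 :=
    intervalIntegral.integral_hasDerivAt_right (hcont.intervalIntegrable _ _)
      hcont.stronglyMeasurable.stronglyMeasurableAtFilter hcont.continuousAt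
  have hlim := (hasDerivAt_iff_tendsto_slope_zero.1 hd).mono_left
    (nhdsWithin_mono 0 fun x (hx : x ∈ Set.Ioi 0) => ne_of_gt hx)
  rw [abs_zero, P.op_zero] at hlim
  simp only [zero_add, intervalIntegral.integral_same, sub_zero] at hlim
  have hvar : ∀ g : Lp ℝ 2 μ, variance (g : X → ℝ) μ =
      ‖g‖ ^ 2 - (inner ℝ g (Lp.const 2 μ (1 : ℝ))) ^ 2 := fun g => by
    rw [variance_Lp_eq, L2.inner_const, one_mul]
  have hv : Continuous fun g : Lp ℝ 2 μ => variance (g : X → ℝ) μ := by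
    simp only [hvar]
    fun_prop
  refine le_of_tendsto ((hv.tendsto f).comp hlim) ?_
  filter_upwards [self_mem_nhdsWithin] with h (hh : 0 < h)
  have hg := P.hasGenerator_integral hh.le f
  -- The time averages of `P_s f` over `[0, h]` lie in the domain of `L` and tend to `f`. Their
  -- energy is `h⁻²` times the integral over `[0, h]` of `⟨P_s f, f - P_h f⟩`, hence at most `e`.
  have hg' : P.HasGenerator (h⁻¹ • ∫ s in (0 : ℝ)..h, P.op |s| f) (h⁻¹ • (P.op h f - f)) := by
    refine (hg.const_smul h⁻¹).congr fun t => ?_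
    rw [map_smul, ← smul_sub, smul_comm]
  refine (hP _ _ hg').trans ?_
  gcongr
  have hint : inner ℝ (f - P.op h f) (∫ s in (0 : ℝ)..h, P.op |s| f) ≤ h * (h * e) := by
    have h1 := (innerSL ℝ (f - P.op h f)).intervalIntegral_comp_comm
      (hcont.intervalIntegrable (μ := volume) 0 h)
    rw [innerSL_apply_apply] at h1
    rw [← h1]
    have h2 : ∫ _ in (0 : ℝ)..h, h * e = h * (h * e) := by simp
    rw [← h2]
    refine intervalIntegral.integral_mono_on hh.le ?_ (by simp) fun s hs => ?_
    · exact ((innerSL ℝ (f - P.op h f)).continuous.comp hcont).intervalIntegrable _ _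
    · rw [innerSL_apply_apply, real_inner_comm, abs_of_nonneg hs.1]
      refine (P.inner_op_sub_op_le hs.1 hh f).trans ?_
      gcongr
      exact he.approxEnergy_le hh
  rw [real_inner_comm, ← neg_sub, inner_neg_right] at hint
  rw [inner_smul_left, inner_smul_right, ← sub_nonneg]
  have : 0 ≤ h⁻¹ * h⁻¹ * (h * (h * e) +
      inner ℝ (∫ s in (0 : ℝ)..h, P.op |s| f) (P.op h f - f)) :=
    mul_nonneg (by positivity) (by linarith)
  refine this.trans_eq ?_
  simp only [conj_trivial]
  field_simp
  ring

end SymmetricMarkovSemigroup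

/-! ### Gaussian sums -/

theorem exists_one_add_pow_mul_exp_le {a : ℝ} (ha : 0 < a) (N : ℕ) :
    ∃ D : ℝ, 0 < D ∧ ∀ y : ℝ, 0 ≤ y → (1 + y) ^ N * Real.exp (-2 * a * y ^ 2) ≤ D := by
  refine ⟨N.factorial / a ^ N * Real.exp (2 * a), by positivity, fun y hy => ?_⟩
  have h1 := Real.pow_div_factorial_le_exp (a * (1 + y)) (by positivity) N
  rw [div_le_iff₀ (by positivity), mul_pow] at h1
  have h2 : Real.exp (a * (1 + y)) * Real.exp (-2 * a * y ^ 2) ≤ Real.exp (2 * a) := by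
    rw [← Real.exp_add]
    refine Real.exp_le_exp.2 ?_
    nlinarith [mul_nonneg ha.le (sq_nonneg (y - 1)), mul_nonneg ha.le (sq_nonneg y)]
  have h3 : (1 + y) ^ N ≤ N.factorial / a ^ N * Real.exp (a * (1 + y)) := by
    rw [div_mul_eq_mul_div, le_div_iff₀ (by positivity)]
    linarith
  calc (1 + y) ^ N * Real.exp (-2 * a * y ^ 2)
      ≤ N.factorial / a ^ N * Real.exp (a * (1 + y)) * Real.exp (-2 * a * y ^ 2) := by gcongr
    _ ≤ N.factorial / a ^ N * Real.exp (2 * a) := by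
      rw [mul_assoc]; gcongr

/-- The scaling is that of `∫ x^r e^{-2as²x²} dx`. The terms with `k ≥ 1` are bounded by a
telescoping sum, and the term `k = 0`, equal to `1`, is absorbed using `s ≤ 1`. -/
theorem exists_sum_rpow_mul_exp_le {a r : ℝ} (ha : 0 < a) (hr : 0 ≤ r) :
    ∃ D : ℝ, 0 < D ∧ ∀ s : ℝ, 0 < s → s ≤ 1 → ∀ N : ℕ,
      ∑ k ∈ Finset.range N, (max (k : ℝ) 1) ^ r * Real.exp (-2 * a * s ^ 2 * (k : ℝ) ^ 2) ≤
        D * s ^ (-(r + 1)) := by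
  -- The power `⌈r⌉₊` pays for `(s k)^r`; the extra `2` leaves the factor `(1 + s k)⁻²` that
  -- telescopes.
  obtain ⟨D, hD, hDle⟩ := exists_one_add_pow_mul_exp_le ha (⌈r⌉₊ + 2)
  refine ⟨1 + D, by positivity, fun s hs hs1 N => ?_⟩
  set A := D * s ^ (-(r + 1)) with hA
  have hA0 : 0 < A := by positivity
  have hone : 1 ≤ s ^ (-(r + 1)) := Real.one_le_rpow_of_pos_of_le_one_of_nonpos hs hs1 (by linarith)
  have hterm : ∀ k : ℕ, (max ((k + 1 : ℕ) : ℝ) 1) ^ r *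
      Real.exp (-2 * a * s ^ 2 * ((k + 1 : ℕ) : ℝ) ^ 2) ≤
      A * (1 / (1 + k * s) - 1 / (1 + (k + 1 : ℕ) * s)) := fun k => by
    have hk : (1 : ℝ) ≤ ((k + 1 : ℕ) : ℝ) := by exact_mod_cast Nat.le_add_left 1 k
    rw [max_eq_left hk]
    set x : ℝ := ((k + 1 : ℕ) : ℝ) with hx
    have hx0 : 0 < x := by linarith
    have hkx : (k : ℝ) = x - 1 := by rw [hx]; push_cast; ring
    have h1 := hDle (s * x) (by positivity)
    have h2 : (s * x) ^ r * (1 + s * x) ^ 2 ≤ (1 + s * x) ^ (⌈r⌉₊ + 2) := by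
      rw [pow_add]
      gcongr
      rw [← Real.rpow_natCast]
      calc (s * x) ^ r ≤ (1 + s * x) ^ r := by gcongr; linarith
        _ ≤ (1 + s * x) ^ ((⌈r⌉₊ : ℕ) : ℝ) :=
          Real.rpow_le_rpow_of_exponent_le (by nlinarith) (Nat.le_ceil r)
    have h3 : x ^ r = s ^ (-r) * (s * x) ^ r := by
      rw [Real.mul_rpow hs.le hx0.le, ← mul_assoc, ← Real.rpow_add hs]
      simp
    have h4 : (s * x) ^ r * Real.exp (-2 * a * (s * x) ^ 2) ≤ D / (1 + s * x) ^ 2 := by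
      rw [le_div_iff₀ (by positivity)]
      refine le_trans ?_ h1
      rw [mul_right_comm]
      gcongr
    have h5 : A * (1 / (1 + k * s) - 1 / (1 + x * s)) =
        s ^ (-r) * (D / ((1 + s * (x - 1)) * (1 + s * x))) := by
      have e1 : s ^ (-(r + 1)) = s ^ (-r) * s⁻¹ := by
        rw [neg_add, Real.rpow_add hs, Real.rpow_neg_one]
      have : 0 < 1 + s * (x - 1) := by nlinarith
      have : 0 < 1 + (x - 1) * s := by nlinarith
      rw [hA, hkx, e1]
      field_simp
      ring
    rw [h5, h3, mul_assoc]
    gcongr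
    have e2 : -2 * a * s ^ 2 * x ^ 2 = -2 * a * (s * x) ^ 2 := by ring
    rw [e2]
    refine h4.trans ?_
    have : 0 < 1 + s * (x - 1) := by nlinarith
    rw [sq]
    gcongr
    linarith
  have key : ∀ N : ℕ, ∑ k ∈ Finset.range (N + 1), (max (k : ℝ) 1) ^ r *
      Real.exp (-2 * a * s ^ 2 * (k : ℝ) ^ 2) ≤ 1 + A * (1 - 1 / (1 + N * s)) := fun N => by
    induction N with
    | zero => simp
    | succ N ih =>
      rw [Finset.sum_range_succ]
      linarith [hterm N]
  have hN : ∑ k ∈ Finset.range N, (max (k : ℝ) 1) ^ r *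
      Real.exp (-2 * a * s ^ 2 * (k : ℝ) ^ 2) ≤ 1 + A * (1 - 1 / (1 + N * s)) := by
    refine le_trans ?_ (key N)
    rw [Finset.sum_range_succ]
    exact le_add_of_nonneg_right (by positivity)
  have : 0 ≤ A * (1 / (1 + N * s)) := by positivity
  linarith

/-! ### Ultracontractivity -/

theorem L2.inner_le_of_eLpNorm_top_le {X : Type*} [MeasurableSpace X] {μ : Measure X}
    [IsProbabilityMeasure μ] {u g : Lp ℝ 2 μ} {M : ℝ} (hM : 0 ≤ M)
    (h : eLpNorm (u : X → ℝ) ∞ μ ≤ ENNReal.ofReal M) : inner ℝ u g ≤ M * ∫ x, |g x| ∂μ := by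
  rw [L2.inner_eq_integral_mul, ← integral_const_mul]
  have hg : Integrable (fun x => |g x|) μ := ((Lp.memLp g).integrable (by norm_num)).abs
  refine integral_mono_ae ((Lp.memLp u).integrable_mul (Lp.memLp g)) (hg.const_mul M) ?_
  rw [eLpNorm_exponent_top] at h
  filter_upwards [ae_le_eLpNormEssSup (f := (u : X → ℝ)) (μ := μ)] with x hx
  have hux : |u x| ≤ M := by
    have := hx.trans h
    rwa [← ofReal_norm, ENNReal.ofReal_le_ofReal_iff hM, Real.norm_eq_abs] at this
  calc u x * g x ≤ |u x * g x| := le_abs_self _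
    _ = |u x| * |g x| := abs_mul _ _
    _ ≤ M * |g x| := by gcongr

namespace SymmetricMarkovSemigroup

variable {X : Type*} [MeasurableSpace X] {μ : Measure X} [IsProbabilityMeasure μ]
  (P : SymmetricMarkovSemigroup μ)

/-- Heat kernel bounds on the summands of an orthogonal decomposition imply ultracontractivity,
stated in the dual form of an `L¹ → L²` bound. -/
theorem exists_norm_op_sq_le (H : ℕ → Submodule ℝ (Lp ℝ 2 μ))
    (hH : IsHilbertSum ℝ (fun k => H k) (fun k => (H k).subtypeₗᵢ))
    {a C p : ℝ} (ha : 0 < a)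
    (hbound : ∀ (k : ℕ) (f : Lp ℝ 2 μ), f ∈ H k → ∀ t : ℝ, 0 < t →
      eLpNorm (P.op t f : X → ℝ) ∞ μ ≤
        ENNReal.ofReal (C * (max (k : ℝ) 1) ^ p * Real.exp (-a * t * (k : ℝ) ^ 2) * ‖f‖))
    {m : ℝ} (hm : 1 ≤ m) (hpm : 2 * p + 1 ≤ m) :
    ∃ K : ℝ, 0 < K ∧ ∀ t : ℝ, 0 < t → t ≤ 1 → ∀ g : Lp ℝ 2 μ,
      ‖P.op t g‖ ^ 2 ≤ K * t ^ (-(m / 2)) * (∫ x, |g x| ∂μ) ^ 2 := by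
  obtain ⟨D, hD, hsum⟩ := exists_sum_rpow_mul_exp_le (r := m - 1) ha (by linarith)
  -- `C ^ 2 + 1` rather than `C ^ 2` keeps the constant positive when `C = 0`.
  refine ⟨(C ^ 2 + 1) * D, by positivity, fun t ht ht1 g => ?_⟩
  set I := ∫ x, |g x| ∂μ with hI
  have hI0 : 0 ≤ I := integral_nonneg fun x => abs_nonneg _
  set f := P.op t g with hf
  set w := hH.linearIsometryEquiv f with hw
  have hws : HasSum (fun k => ((w k : H k) : Lp ℝ 2 μ)) f := by
    have := hH.hasSum_linearIsometryEquiv_symm w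
    rwa [hw, LinearIsometryEquiv.symm_apply_apply] at this
  have hinner : HasSum (fun k => inner ℝ (P.op t (w k : H k)) g) (‖f‖ ^ 2) := by
    have h1 := (innerSL ℝ g).hasSum ((P.op t).hasSum hws)
    simp only [innerSL_apply_apply] at h1
    rw [real_inner_comm, P.symm t ht.le, real_inner_self_eq_norm_sq] at h1
    exact h1.congr_fun fun k => real_inner_comm _ _
  set B : ℕ → ℝ := fun k => |C| * (max (k : ℝ) 1) ^ ((m - 1) / 2) *
    Real.exp (-a * t * (k : ℝ) ^ 2) with hB
  have hB0 : ∀ k, 0 ≤ B k := fun k => by positivity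
  have hBsq : ∀ N, ∑ k ∈ Finset.range N, B k ^ 2 ≤ (C ^ 2 + 1) * D * t ^ (-(m / 2)) := fun N => by
    -- The scale `s = √t` with `r = m - 1` turns `s^{-(r+1)}` into `t^{-m/2}`.
    have h1 := hsum (√t) (Real.sqrt_pos.2 ht) (Real.sqrt_le_one.2 ht1) N
    rw [Real.sq_sqrt ht.le, Real.sqrt_eq_rpow, ← Real.rpow_mul ht.le] at h1
    have h2 : (1 / 2 : ℝ) * -(m - 1 + 1) = -(m / 2) := by ring
    rw [h2] at h1
    have h3 : ∀ k : ℕ, B k ^ 2 = C ^ 2 * ((max (k : ℝ) 1) ^ (m - 1) *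
        Real.exp (-2 * a * t * (k : ℝ) ^ 2)) := fun k => by
      rw [hB]
      simp only
      rw [mul_pow, mul_pow, sq_abs, ← Real.rpow_natCast (max (k : ℝ) 1 ^ ((m - 1) / 2)), ← Real.rpow_mul (by positivity),
        ← Real.exp_nat_mul, mul_assoc]
      congr 3
      · push_cast; ring
      · push_cast; ring
    simp only [h3]
    rw [← Finset.mul_sum]
    have h4 : 0 ≤ D * t ^ (-(m / 2)) := by positivity
    linarith [mul_le_mul_of_nonneg_left h1 (sq_nonneg C)]
  have hterm : ∀ k, inner ℝ (P.op t (w k : H k)) g ≤ B k * ‖w k‖ * I := fun k => by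
    refine L2.inner_le_of_eLpNorm_top_le (mul_nonneg (hB0 k) (norm_nonneg _)) ?_
    refine (hbound k _ (w k).2 t ht).trans (ENNReal.ofReal_le_ofReal ?_)
    have h1 : (max (k : ℝ) 1) ^ p ≤ (max (k : ℝ) 1) ^ ((m - 1) / 2) :=
      Real.rpow_le_rpow_of_exponent_le (le_max_right _ _) (by linarith)
    rw [hB]
    simp only [Submodule.coe_norm]
    gcongr
    exact le_abs_self C
  have hwsq : ∀ N, ∑ k ∈ Finset.range N, ‖w k‖ ^ 2 ≤ ‖f‖ ^ 2 := fun N => by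
    have := lp.sum_rpow_le_norm_rpow (p := 2) (by norm_num) w (Finset.range N)
    rw [hw, LinearIsometryEquiv.norm_map] at this
    simpa using this
  set Q := (C ^ 2 + 1) * D * t ^ (-(m / 2)) with hQ
  have hQ0 : 0 ≤ Q := by positivity
  have hpart : ∀ N, ∑ k ∈ Finset.range N, inner ℝ (P.op t (w k : H k)) g ≤ √Q * ‖f‖ * I :=
    fun N => by
      refine (Finset.sum_le_sum fun k _ => hterm k).trans ?_
      rw [← Finset.sum_mul]
      gcongr
      refine (Real.sum_mul_le_sqrt_mul_sqrt _ _ _).trans ?_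
      gcongr
      · exact hBsq N
      · exact Real.sqrt_le_iff.2 ⟨norm_nonneg f, hwsq N⟩
  have hle : ‖f‖ ^ 2 ≤ √Q * ‖f‖ * I :=
    le_of_tendsto hinner.tendsto_sum_nat (Eventually.of_forall hpart)
  have hle' : ‖f‖ ≤ √Q * I := by
    rcases (norm_nonneg f).eq_or_lt with h0 | h0
    · rw [← h0]; positivity
    · nlinarith
  calc ‖f‖ ^ 2 ≤ (√Q * I) ^ 2 := by gcongr
    _ = Q * I ^ 2 := by rw [mul_pow, Real.sq_sqrt hQ0]

end SymmetricMarkovSemigroup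

/-! ### Absorption and level-set estimates -/

theorem exists_sum_le_of_le_rpow_mul_add {D A θ : ℝ} (hD : 0 ≤ D) (hA : 0 ≤ A) (hθ : 0 < θ)
    (hθ1 : θ < 1) : ∃ B : ℝ, 0 < B ∧ ∀ a e : ℕ → ℝ, (∀ j, 0 ≤ a j) → (∀ j, 0 ≤ e j) →
      (∀ J, ∑ j ∈ Finset.range J, e j ≤ 1) → a 0 ≤ A →
      (∀ j, a (j + 1) ≤ D * a j ^ θ * e j + a j / 2) →
      ∀ J, ∑ j ∈ Finset.range J, a j ≤ B := by
  refine ⟨1 + (2 * A + 2 * D) ^ (1 / (1 - θ)), by positivity, fun a e ha he hsum h0 hrec J => ?_⟩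
  have hmono : ∑ j ∈ Finset.range J, a j ≤ ∑ j ∈ Finset.range (J + 1), a j := by
    rw [Finset.sum_range_succ]; linarith [ha J]
  refine hmono.trans ?_
  set S := ∑ j ∈ Finset.range (J + 1), a j with hS
  have hS0 : 0 ≤ S := Finset.sum_nonneg fun j _ => ha j
  have hle : ∀ j ∈ Finset.range J, a j ≤ S := fun j hj =>
    Finset.single_le_sum (f := a) (fun i _ => ha i)
      (Finset.mem_range.2 ((Finset.mem_range.1 hj).trans (Nat.lt_succ_self J)))
  -- Bounding each `a j ^ θ` by `S ^ θ` lets the energies sum to at most `1`. As `S` is finite, `S /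
  -- 2` can be absorbed, and `θ < 1` then bounds `S`.
  have h1 : S ≤ A + (D * S ^ θ + S / 2) := by
    calc S = ∑ j ∈ Finset.range J, a (j + 1) + a 0 := Finset.sum_range_succ' _ _
      _ ≤ ∑ j ∈ Finset.range J, (D * S ^ θ * e j + a j / 2) + A := by
        gcongr with j hj
        refine (hrec j).trans ?_
        gcongr
        · exact he j
        · exact ha j
        · exact hle j hj
      _ = D * S ^ θ * ∑ j ∈ Finset.range J, e j + (∑ j ∈ Finset.range J, a j) / 2 + A := by
        rw [Finset.sum_add_distrib, Finset.mul_sum, Finset.sum_div]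
      _ ≤ D * S ^ θ * 1 + S / 2 + A := by
        gcongr
        exact hsum J
      _ = A + (D * S ^ θ + S / 2) := by ring
  rcases le_total S 1 with h | h
  · have : 0 ≤ (2 * A + 2 * D) ^ (1 / (1 - θ)) := by positivity
    linarith
  · have hpos : 0 < S := by linarith
    have h2 : 1 ≤ S ^ θ := Real.one_le_rpow h hθ.le
    have h3 : S ≤ (2 * A + 2 * D) * S ^ θ := by nlinarith
    have h4 : S ^ (1 - θ) ≤ 2 * A + 2 * D := by
      rw [Real.rpow_sub hpos, Real.rpow_one, div_le_iff₀ (by positivity)]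
      exact h3
    have h5 : S ≤ (2 * A + 2 * D) ^ (1 / (1 - θ)) := by
      calc S = (S ^ (1 - θ)) ^ (1 / (1 - θ)) := by
            rw [← Real.rpow_mul hS0, mul_one_div_cancel (by linarith), Real.rpow_one]
        _ ≤ _ := by
          have : 0 ≤ 1 / (1 - θ) := by apply one_div_nonneg.2; linarith
          gcongr
    linarith

theorem Lp.measurableSet_le_coeFn {X : Type*} [MeasurableSpace X] {μ : Measure X} (f : Lp ℝ 2 μ)
    (l : ℝ) : MeasurableSet {x | l ≤ f x} :=
  measurableSet_le measurable_const (Lp.stronglyMeasurable f).measurable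

theorem Lp.sq_mul_measure_le_norm_sq {X : Type*} [MeasurableSpace X] {μ : Measure X} {f g : Lp ℝ 2 μ} {l c : ℝ}
    (hc : 0 ≤ c)   (h : ∀ᵐ x ∂μ, l ≤ f x → c ≤ g x) : c ^ 2 * μ.real {x | l ≤ f x} ≤ ‖g‖ ^ 2 := by
  rw [← real_inner_self_eq_norm_sq, L2.inner_eq_integral_mul, mul_comm, ← smul_eq_mul,
    ← integral_indicator_const _ (Lp.measurableSet_le_coeFn f l)]
  refine integral_mono_of_nonneg (ae_of_all _ fun x => ?_)
    ((Lp.memLp g).integrable_mul (Lp.memLp g)) ?_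
  · exact Set.indicator_nonneg (fun _ _ => by positivity) _
  · filter_upwards [h] with x hx
    by_cases hl : l ≤ f x
    · rw [Set.indicator_of_mem (by exact hl), ← sq]
      have := hx hl
      gcongr
    · rw [Set.indicator_of_notMem (by exact hl)]
      exact mul_self_nonneg _

/-! ### Dyadic slices of a function -/

section Slices

variable {X : Type*} [MeasurableSpace X] {μ : Measure X} [IsProbabilityMeasure μ]

/-- The slice `(f - l)₊ ∧ l` of a function `f` between the levels `l` and `2 l`. -/
noncomputable def Lp.slice (f : Lp ℝ 2 μ) (l : ℝ) : Lp ℝ 2 μ :=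
  f ⊓ Lp.const 2 μ (2 * l) - f ⊓ Lp.const 2 μ l

theorem Lp.coeFn_inf_const (f : Lp ℝ 2 μ) (c : ℝ) :
    (f ⊓ Lp.const 2 μ c : Lp ℝ 2 μ) =ᵐ[μ] fun x => min (f x) c := by
  filter_upwards [Lp.coeFn_inf f (Lp.const 2 μ c), Lp.coeFn_const (μ := μ) 2 c] with x h1 h2
  rw [h1, Pi.inf_apply, h2]
  rfl

theorem Lp.coeFn_slice (f : Lp ℝ 2 μ) (l : ℝ) :
    Lp.slice f l =ᵐ[μ] fun x => min (f x) (2 * l) - min (f x) l := by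
  filter_upwards [Lp.coeFn_sub (f ⊓ Lp.const 2 μ (2 * l)) (f ⊓ Lp.const 2 μ l),
    Lp.coeFn_inf_const f (2 * l), Lp.coeFn_inf_const f l] with x h1 h2 h3
  rw [Lp.slice, h1, Pi.sub_apply, h2, h3]

theorem Lp.sq_mul_measure_le_norm_slice_sq (f : Lp ℝ 2 μ) {l : ℝ} (hl : 0 ≤ l) :
    l ^ 2 * μ.real {x | 2 * l ≤ f x} ≤ ‖Lp.slice f l‖ ^ 2 := by
  refine Lp.sq_mul_measure_le_norm_sq hl ?_
  filter_upwards [Lp.coeFn_slice f l] with x hx h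
  rw [hx, min_eq_right h, min_eq_right (by linarith)]
  linarith

theorem Lp.integral_abs_slice_le (f : Lp ℝ 2 μ) {l : ℝ} (hl : 0 ≤ l) :
    ∫ x, |Lp.slice f l x| ∂μ ≤ l * μ.real {x | l ≤ f x} := by
  rw [mul_comm, ← smul_eq_mul, ← integral_indicator_const _ (Lp.measurableSet_le_coeFn f l)]
  refine integral_mono_of_nonneg (ae_of_all _ fun x => abs_nonneg _)
    ((integrable_const l).indicator (Lp.measurableSet_le_coeFn f l)) ?_
  filter_upwards [Lp.coeFn_slice f l] with x hx
  rw [hx]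
  by_cases h : l ≤ f x
  · rw [Set.indicator_of_mem (by exact h), min_eq_right h, abs_le]
    constructor
    · linarith [le_min h (by linarith : l ≤ 2 * l)]
    · linarith [min_le_right (f x) (2 * l)]
  · rw [Set.indicator_of_notMem (by exact h), min_eq_left (by linarith), min_eq_left (by linarith)]
    simp

theorem Lp.slice_le_const (f : Lp ℝ 2 μ) {l : ℝ} (hl : 0 ≤ l) :
    Lp.slice f l ≤ Lp.const 2 μ l := by
  rw [← Lp.coeFn_le]
  filter_upwards [Lp.coeFn_slice f l, Lp.coeFn_const (μ := μ) 2 l] with x hx h1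
  rw [hx, h1, Function.const_apply]
  rcases le_total l (f x) with h | h
  · linarith [min_eq_right h, min_le_right (f x) (2 * l)]
  · linarith [min_eq_left h, min_le_left (f x) (2 * l)]

theorem Lp.inner_eq_inner_const {u f : Lp ℝ 2 μ} {c l : ℝ} (h : ∀ᵐ x ∂μ, l ≤ f x → u x = c) :
    inner ℝ u (f - f ⊓ Lp.const 2 μ l) =
      inner ℝ (Lp.const 2 μ c) (f - f ⊓ Lp.const 2 μ l) := by
  rw [L2.inner_eq_integral_mul, L2.inner_eq_integral_mul]
  refine integral_congr_ae ?_
  filter_upwards [h, Lp.coeFn_sub f (f ⊓ Lp.const 2 μ l), Lp.coeFn_inf_const f l,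
    Lp.coeFn_const (μ := μ) 2 c] with x h1 h2 h3 h4
  rw [h4, h2, Pi.sub_apply, h3]
  rcases le_total l (f x) with hl | hl
  · rw [h1 hl]; rfl
  · rw [min_eq_left hl]; simp

/-- The slices are peeled off the remainder `(f - l 2^j)₊` one at a time by `approxEnergy_add_le`:
each slice attains its maximum wherever the next remainder is nonzero. -/
theorem SymmetricMarkovSemigroup.sum_approxEnergy_slice_le (P : SymmetricMarkovSemigroup μ)
    {t : ℝ} (ht : 0 < t) (f : Lp ℝ 2 μ) {l : ℝ} (hl : 0 ≤ l) (J : ℕ) :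
    ∑ j ∈ Finset.range J, P.approxEnergy t (Lp.slice f (l * 2 ^ j)) ≤ P.approxEnergy t f := by
  have hsub : ∀ c, 0 ≤ f - f ⊓ Lp.const 2 μ c := fun c => sub_nonneg.2 inf_le_left
  suffices h : ∑ j ∈ Finset.range J, P.approxEnergy t (Lp.slice f (l * 2 ^ j)) +
      P.approxEnergy t (f - f ⊓ Lp.const 2 μ (l * 2 ^ J)) ≤ P.approxEnergy t f by
    linarith [P.approxEnergy_nonneg ht (f - f ⊓ Lp.const 2 μ (l * 2 ^ J))]
  induction J with
  | zero =>
    have h1 := P.approxEnergy_add_le ht (u := f ⊓ Lp.const 2 μ l) inf_le_right (hsub l)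
      (Lp.inner_eq_inner_const (by
        filter_upwards [Lp.coeFn_inf_const f l] with x hx h
        rw [hx, min_eq_right h]))
    rw [add_sub_cancel] at h1
    simp only [Finset.range_zero, Finset.sum_empty, pow_zero, mul_one, zero_add]
    linarith [P.approxEnergy_nonneg ht (f ⊓ Lp.const 2 μ l)]
  | succ J ih =>
    have hlJ : 0 ≤ l * 2 ^ J := by positivity
    have h1 := P.approxEnergy_add_le ht (Lp.slice_le_const f hlJ) (hsub (2 * (l * 2 ^ J)))
      (Lp.inner_eq_inner_const (by
        filter_upwards [Lp.coeFn_slice f (l * 2 ^ J)] with x hx h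
        rw [hx, min_eq_right h, min_eq_right (by linarith)]
        ring))
    have h2 : Lp.slice f (l * 2 ^ J) + (f - f ⊓ Lp.const 2 μ (2 * (l * 2 ^ J))) =
        f - f ⊓ Lp.const 2 μ (l * 2 ^ J) := by
      rw [Lp.slice]; abel
    rw [h2] at h1
    have h3 : l * 2 ^ (J + 1) = 2 * (l * 2 ^ J) := by ring
    rw [Finset.sum_range_succ, h3]
    linarith

/-- Dyadic layer cake: where `f ≥ l`, some `j` has `l 2^j ≤ f < l 2^{j+1}`, and then `f^q ≤ 2^q (l
2^j)^q`. -/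
theorem Lp.lintegral_rpow_le_of_sum_le {q l B : ℝ} (hq : 0 ≤ q) (hl : 0 < l) {f : Lp ℝ 2 μ}
    (hB : ∀ J, ∑ j ∈ Finset.range J, (l * 2 ^ j) ^ q * μ.real {x | l * 2 ^ j ≤ f x} ≤ B)
    (hf : 0 ≤ f) :
    ∫⁻ x, ‖f x‖ₑ ^ q ∂μ ≤ ENNReal.ofReal (l ^ q + 2 ^ q * B) := by
  have hpt : ∀ᵐ x ∂μ, ‖f x‖ₑ ^ q ≤ ENNReal.ofReal (l ^ q) +
      ∑' j : ℕ, {x | l * 2 ^ j ≤ f x}.indicator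
        (fun _ => ENNReal.ofReal (2 ^ q * (l * 2 ^ j) ^ q)) x := by
    filter_upwards [(Lp.coeFn_nonneg f).2 hf] with x hx
    have hx0 : 0 ≤ f x := hx
    rw [Real.enorm_of_nonneg hx0, ENNReal.ofReal_rpow_of_nonneg hx0 hq]
    rcases le_total (f x) l with h | h
    · exact le_add_right (ENNReal.ofReal_le_ofReal (by gcongr))
    · obtain ⟨j, hj1, hj2⟩ := exists_nat_pow_near ((one_le_div hl).2 h) (one_lt_two (α := ℝ))
      rw [le_div_iff₀ hl] at hj1
      rw [div_lt_iff₀ hl] at hj2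
      refine le_add_left (le_trans ?_ (ENNReal.le_tsum j))
      rw [Set.indicator_of_mem (by simpa [mul_comm] using hj1)]
      refine ENNReal.ofReal_le_ofReal ?_
      rw [← Real.mul_rpow (by norm_num) (by positivity)]
      gcongr
      rw [pow_succ] at hj2
      linarith
  refine (lintegral_mono_ae hpt).trans ?_
  rw [lintegral_add_left measurable_const, lintegral_tsum fun j =>
    (measurable_const.indicator (Lp.measurableSet_le_coeFn f _)).aemeasurable]
  have hB0 : 0 ≤ B := by simpa using hB 0
  rw [ENNReal.ofReal_add (by positivity) (by positivity)]
  refine add_le_add (by simp) ?_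
  rw [ENNReal.tsum_eq_iSup_nat]
  refine iSup_le fun J => ?_
  have hterm : ∀ j : ℕ, ∫⁻ x, {x | l * 2 ^ j ≤ f x}.indicator
      (fun _ => ENNReal.ofReal (2 ^ q * (l * 2 ^ j) ^ q)) x ∂μ =
      ENNReal.ofReal (2 ^ q * ((l * 2 ^ j) ^ q * μ.real {x | l * 2 ^ j ≤ f x})) := fun j => by
    rw [lintegral_indicator_const (Lp.measurableSet_le_coeFn f _), ← mul_assoc,
      ENNReal.ofReal_mul (p := 2 ^ q * (l * 2 ^ j) ^ q) (by positivity), ofReal_measureReal]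
  simp only [hterm]
  rw [← ENNReal.ofReal_sum_of_nonneg fun j _ => by positivity, ← Finset.mul_sum]
  refine ENNReal.ofReal_le_ofReal ?_
  gcongr
  exact hB J

end Slices

/-! ### Sobolev inequality with a non-optimal constant -/

namespace SymmetricMarkovSemigroup

variable {X : Type*} [MeasurableSpace X] {μ : Measure X} [IsProbabilityMeasure μ]
  (P : SymmetricMarkovSemigroup μ)

theorem norm_sq_le_of_norm_op_sq_le {m K : ℝ} (hK : ∀ t : ℝ, 0 < t → t ≤ 1 → ∀ g : Lp ℝ 2 μ,
      ‖P.op t g‖ ^ 2 ≤ K * t ^ (-(m / 2)) * (∫ x, |g x| ∂μ) ^ 2)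
    {t : ℝ} (ht : 0 < t) (ht1 : t ≤ 1) (g : Lp ℝ 2 μ) :
    ‖g‖ ^ 2 ≤ t * P.approxEnergy t g +
      K * 2 ^ (m / 2) * t ^ (-(m / 2)) * (∫ x, |g x| ∂μ) ^ 2 := by
  have h1 := hK (t / 2) (by positivity) (by linarith) g
  rw [← P.inner_op_two_mul (by positivity), add_halves, Real.div_rpow ht.le (by norm_num),
    Real.rpow_neg (by norm_num : (0 : ℝ) ≤ 2), div_inv_eq_mul] at h1
  have h2 := P.mul_approxEnergy ht g
  have h3 : K * (t ^ (-(m / 2)) * 2 ^ (m / 2)) = K * 2 ^ (m / 2) * t ^ (-(m / 2)) := by ring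
  rw [h3] at h1
  linarith

/-- Estimate of the measure of a level set by that of the level set at half the height, with a
dyadic time chosen according to the latter. -/
theorem exists_sq_mul_measure_le {m K θ : ℝ} (hm : 0 < m) (hK : 0 < K) (hθ : 0 < θ)
    (hnash : ∀ t : ℝ, 0 < t → t ≤ 1 → ∀ g : Lp ℝ 2 μ,
      ‖g‖ ^ 2 ≤ t * P.approxEnergy t g + K * t ^ (-(m / 2)) * (∫ x, |g x| ∂μ) ^ 2)
    (f : Lp ℝ 2 μ) {l : ℝ} (hl : 0 ≤ l) (hμ : K * μ.real {x | l ≤ f x} ≤ θ) :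
    ∃ n : ℕ, l ^ 2 * μ.real {x | 2 * l ≤ f x} ≤
      2 * (K / θ) ^ (2 / m) * μ.real {x | l ≤ f x} ^ (2 / m) *
        P.approxEnergy (1 / 2 ^ n) (Lp.slice f l) + θ * (l ^ 2 * μ.real {x | l ≤ f x}) := by
  set y := μ.real {x | l ≤ f x} with hy
  have hy0 : 0 ≤ y := measureReal_nonneg
  rcases hy0.eq_or_lt with h0 | hypos
  -- The optimal time would be `0` here; any time works since the level set is null.
  · refine ⟨0, ?_⟩
    have h1 : μ.real {x | 2 * l ≤ f x} ≤ y := by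
      refine measureReal_mono fun x (hx : 2 * l ≤ f x) => ?_
      exact le_trans (by linarith) hx
    have h2 : μ.real {x | 2 * l ≤ f x} = 0 := le_antisymm (h1.trans h0.ge) measureReal_nonneg
    rw [h2, mul_zero]
    have := P.approxEnergy_nonneg (t := 1 / 2 ^ 0) (by norm_num) (Lp.slice f l)
    positivity
  · have hx0 : 0 < K / θ * y := by positivity
    have hx1 : K / θ * y ≤ 1 := by rwa [div_mul_eq_mul_div, div_le_one hθ]
    -- The time `t = 2⁻ⁿ` is within a factor `2` above `(K y / θ)^{2/m}`, where `K t^{-m/2} y = θ`.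
    -- The smallness hypothesis on `y` ensures `t ≤ 1`.
    obtain ⟨n, hn1, hn2⟩ := exists_nat_pow_near_of_lt_one (x := (K / θ * y) ^ (2 / m))
      (y := (1 / 2 : ℝ)) (by positivity) (Real.rpow_le_one hx0.le hx1 (by positivity))
      (by norm_num) (by norm_num)
    refine ⟨n, ?_⟩
    rw [← one_div_pow]
    set t := (1 / 2 : ℝ) ^ n with ht
    have ht0 : 0 < t := by positivity
    have ht1 : t ≤ 1 := pow_le_one₀ (by norm_num) (by norm_num)
    have h1 := (Lp.sq_mul_measure_le_norm_slice_sq f hl).trans (hnash t ht0 ht1 (Lp.slice f l))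
    have h2 : t ≤ 2 * (K / θ) ^ (2 / m) * y ^ (2 / m) := by
      rw [mul_assoc, ← Real.mul_rpow (by positivity) hy0]
      rw [pow_succ] at hn1
      linarith
    have h3 : K * t ^ (-(m / 2)) * y ≤ θ := by
      have h4 : t ^ (-(m / 2)) ≤ ((K / θ * y) ^ (2 / m)) ^ (-(m / 2)) :=
        Real.rpow_le_rpow_of_nonpos (by positivity) hn2 (by linarith)
      rw [← Real.rpow_mul hx0.le] at h4
      have h5 : 2 / m * -(m / 2) = -1 := by field_simp
      rw [h5, Real.rpow_neg_one] at h4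
      calc K * t ^ (-(m / 2)) * y ≤ K * (K / θ * y)⁻¹ * y := by gcongr
        _ = θ := by field_simp
    have h6 := P.approxEnergy_nonneg ht0 (Lp.slice f l)
    refine h1.trans (add_le_add (by gcongr) ?_)
    have h7 : (∫ x, |Lp.slice f l x| ∂μ) ^ 2 ≤ (l * y) ^ 2 := by
      have := Lp.integral_abs_slice_le f hl
      have h8 : 0 ≤ ∫ x, |Lp.slice f l x| ∂μ := integral_nonneg fun x => abs_nonneg _
      gcongr
    calc K * t ^ (-(m / 2)) * (∫ x, |Lp.slice f l x| ∂μ) ^ 2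
        ≤ K * t ^ (-(m / 2)) * (l * y) ^ 2 := by gcongr
      _ = (K * t ^ (-(m / 2)) * y) * (l ^ 2 * y) := by ring
      _ ≤ θ * (l ^ 2 * y) := by gcongr

theorem exists_lintegral_rpow_le {m K : ℝ} (hm : 2 < m) (hK : 0 < K)
    (hnash : ∀ t : ℝ, 0 < t → t ≤ 1 → ∀ g : Lp ℝ 2 μ,
      ‖g‖ ^ 2 ≤ t * P.approxEnergy t g + K * t ^ (-(m / 2)) * (∫ x, |g x| ∂μ) ^ 2) :
    ∃ B : ℝ, 0 < B ∧ ∀ f : Lp ℝ 2 μ, 0 ≤ f → ‖f‖ ≤ 1 →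
      (∀ t, 0 < t → P.approxEnergy t f ≤ 1) →
      ∫⁻ x, ‖f x‖ₑ ^ (2 * m / (m - 2)) ∂μ ≤ ENNReal.ofReal B := by
  have hm2 : 0 < m - 2 := by linarith
  set q := 2 * m / (m - 2) with hq
  have hq0 : 0 < q := by positivity
  have hqm : q * (2 / m) = q - 2 := by rw [hq]; field_simp; ring
  -- Doubling the level costs `2 ^ q` in the weight, so this `θ` leaves the coefficient `1 / 2`
  -- required by the absorption lemma.
  set θ : ℝ := 1 / (2 * 2 ^ q) with hθ
  have hθ0 : 0 < θ := by positivity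
  -- With this base level, Chebyshev's inequality and `‖f‖ ≤ 1` give the smallness condition at
  -- every level.
  set l := √(K / θ) with hl
  have hl0 : 0 < l := Real.sqrt_pos.2 (by positivity)
  have hlsq : l ^ 2 = K / θ := Real.sq_sqrt (by positivity)
  obtain ⟨B, hB, hBsum⟩ := exists_sum_le_of_le_rpow_mul_add
    (D := 2 ^ q * (2 * (K / θ) ^ (2 / m))) (A := l ^ q) (θ := 2 / m)
    (by positivity) (by positivity) (by positivity) (by rw [div_lt_one (by linarith)]; exact hm)
  refine ⟨l ^ q + 2 ^ q * B, by positivity, fun f hf hf1 he => ?_⟩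
  have hcheb : ∀ j : ℕ, K * μ.real {x | l * 2 ^ j ≤ f x} ≤ θ := fun j => by
    have h1 : l ^ 2 * μ.real {x | l * 2 ^ j ≤ f x} ≤ ‖f‖ ^ 2 := by
      refine Lp.sq_mul_measure_le_norm_sq hl0.le (ae_of_all _ fun x hx => le_trans ?_ hx)
      exact le_mul_of_one_le_right hl0.le (one_le_pow₀ (by norm_num))
    have h2 : l ^ 2 * μ.real {x | l * 2 ^ j ≤ f x} ≤ 1 :=
      h1.trans (pow_le_one₀ (norm_nonneg f) hf1)
    rwa [hlsq, div_mul_eq_mul_div, div_le_one hθ0] at h2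
  choose n hn using fun j : ℕ => P.exists_sq_mul_measure_le (by linarith) hK hθ0 hnash f
    (l := l * 2 ^ j) (by positivity) (hcheb j)
  refine Lp.lintegral_rpow_le_of_sum_le hq0.le hl0 (fun J => ?_) hf
  refine hBsum (fun j => (l * 2 ^ j) ^ q * μ.real {x | l * 2 ^ j ≤ f x})
    (fun j => P.approxEnergy (1 / 2 ^ n j) (Lp.slice f (l * 2 ^ j))) (fun j => by positivity)
    (fun j => P.approxEnergy_nonneg (by positivity) _) (fun J => ?_) ?_ (fun j => ?_) J
  -- The times depend on `j`; dyadic monotonicity moves them all to the smallest one, where the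
  -- slice energies can be summed.
  · have h1 : ∀ j ∈ Finset.range J, P.approxEnergy (1 / 2 ^ n j) (Lp.slice f (l * 2 ^ j)) ≤
        P.approxEnergy (1 / 2 ^ ((Finset.range J).sup n)) (Lp.slice f (l * 2 ^ j)) :=
      fun j hj => P.approxEnergy_le_div_pow one_pos _ (Finset.le_sup hj)
    refine (Finset.sum_le_sum h1).trans ?_
    exact (P.sum_approxEnergy_slice_le (by positivity) f hl0.le J).trans (he _ (by positivity))
  · simp only [pow_zero, mul_one]
    exact mul_le_of_le_one_right (by positivity) measureReal_le_one
  · have hL : 0 < l * 2 ^ j := by positivity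
    have h1 : l * 2 ^ (j + 1) = 2 * (l * 2 ^ j) := by ring
    simp only [h1]
    have hnj := hn j
    set L := l * 2 ^ j with hLdef
    set y := μ.real {x | L ≤ f x} with hy
    have hy0 : 0 ≤ y := measureReal_nonneg
    have h2 : L ^ q = L ^ (q - 2) * L ^ 2 := by
      rw [← Real.rpow_natCast, ← Real.rpow_add hL]; norm_num
    have h3 : (L ^ q * y) ^ (2 / m) = L ^ (q - 2) * y ^ (2 / m) := by
      rw [Real.mul_rpow (by positivity) hy0, ← Real.rpow_mul hL.le, hqm]
    have hθ2 : 2 ^ q * θ = 1 / 2 := by rw [hθ]; field_simp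
    rw [h3, Real.mul_rpow (by norm_num) hL.le]
    calc 2 ^ q * L ^ q * μ.real {x | 2 * L ≤ f x}
        = 2 ^ q * L ^ (q - 2) * (L ^ 2 * μ.real {x | 2 * L ≤ f x}) := by rw [h2]; ring
      _ ≤ 2 ^ q * L ^ (q - 2) * (2 * (K / θ) ^ (2 / m) * y ^ (2 / m) *
          P.approxEnergy (1 / 2 ^ n j) (Lp.slice f L) + θ * (L ^ 2 * y)) := by gcongr
      _ = 2 ^ q * (2 * (K / θ) ^ (2 / m)) * (L ^ (q - 2) * y ^ (2 / m)) *
          P.approxEnergy (1 / 2 ^ n j) (Lp.slice f L) + (2 ^ q * θ) * (L ^ q * y) := by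
        rw [h2]; ring
      _ = _ := by rw [hθ2]; ring

/-- The Sobolev inequality with a non-optimal constant in front of the `L²` norm. -/
theorem exists_eLpNorm_sq_le {m K : ℝ} (hm : 2 < m) (hK : 0 < K)
    (hnash : ∀ t : ℝ, 0 < t → t ≤ 1 → ∀ g : Lp ℝ 2 μ,
      ‖g‖ ^ 2 ≤ t * P.approxEnergy t g + K * t ^ (-(m / 2)) * (∫ x, |g x| ∂μ) ^ 2) :
    ∃ A : ℝ, 0 < A ∧ ∀ (f : Lp ℝ 2 μ) (e : ℝ),
      (∀ t, 0 < t → P.approxEnergy t f ≤ e) →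
      eLpNorm (f : X → ℝ) (ENNReal.ofReal (2 * m / (m - 2))) μ ^ 2 ≤
        ENNReal.ofReal (A * (‖f‖ ^ 2 + e)) := by
  obtain ⟨B, hB, hBle⟩ := P.exists_lintegral_rpow_le hm hK hnash
  have hm2 : 0 < m - 2 := by linarith
  set q := 2 * m / (m - 2) with hq
  have hq0 : 0 < q := by positivity
  refine ⟨(B ^ (1 / q)) ^ 2, by positivity, fun f e he => ?_⟩
  have he0 : 0 ≤ e := (P.approxEnergy_nonneg one_pos f).trans (he 1 one_pos)
  set R := ‖f‖ ^ 2 + e with hR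
  have hR0 : 0 ≤ R := by positivity
  rcases hR0.eq_or_lt with h0 | hRpos
  · have : ‖f‖ = 0 := by
      have : ‖f‖ ^ 2 = 0 := le_antisymm (by linarith) (sq_nonneg _)
      simpa using this
    rw [norm_eq_zero] at this
    rw [this, eLpNorm_congr_ae (Lp.coeFn_zero ℝ 2 μ)]
    simp
  set r := √R with hr
  have hr0 : 0 < r := Real.sqrt_pos.2 hRpos
  have hrsq : r ^ 2 = R := Real.sq_sqrt hR0
  -- Passing to `|f|` does not increase any approximate energy, and dividing by `r = (‖f‖² +
  -- e)^{1/2}` normalises both the norm and the energies.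
  have hg := hBle (r⁻¹ • |f|) ?_ ?_ ?_
  · have h1 : eLpNorm (r⁻¹ • |f| : Lp ℝ 2 μ) (ENNReal.ofReal q) μ ≤
        ENNReal.ofReal (B ^ (1 / q)) := by
      rw [eLpNorm_eq_lintegral_rpow_enorm_toReal (by simpa using hq0) (by simp),
        ENNReal.toReal_ofReal hq0.le, ← ENNReal.ofReal_rpow_of_pos hB]
      gcongr
    have h2 : eLpNorm (f : X → ℝ) (ENNReal.ofReal q) μ =
        ENNReal.ofReal r * eLpNorm (r⁻¹ • |f| : Lp ℝ 2 μ) (ENNReal.ofReal q) μ := by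
      rw [← Real.enorm_of_nonneg hr0.le, ← eLpNorm_const_smul]
      refine eLpNorm_congr_norm_ae ?_
      filter_upwards [Lp.coeFn_smul r⁻¹ |f|, Lp.coeFn_abs f] with x hx1 hx2
      rw [Pi.smul_apply, hx1, Pi.smul_apply, hx2, smul_inv_smul₀ hr0.ne', norm_abs_eq_norm]
    rw [h2, ← hrsq, mul_comm, ← mul_pow, ENNReal.ofReal_pow (by positivity),
      ENNReal.ofReal_mul (by positivity)]
    gcongr
  · rw [← Lp.coeFn_nonneg]
    filter_upwards [Lp.coeFn_smul r⁻¹ |f|, Lp.coeFn_abs f] with x hx1 hx2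
    rw [hx1, Pi.smul_apply, hx2]
    exact smul_nonneg (by positivity) (abs_nonneg (f x))
  · rw [norm_smul, norm_abs_eq_norm, norm_inv, Real.norm_of_nonneg hr0.le, inv_mul_le_one₀ hr0]
    exact Real.le_sqrt_of_sq_le (by linarith)
  · intro t ht
    rw [P.approxEnergy_smul, inv_pow, hrsq, inv_mul_le_one₀ hRpos]
    have := (P.approxEnergy_abs_le ht f).trans (he t ht)
    nlinarith [sq_nonneg ‖f‖]

end SymmetricMarkovSemigroup

/-! ### Tightening: the norm of a constant plus a centred function -/

theorem exists_abs_one_add_rpow_le {q : ℝ} (hq : 1 ≤ q) :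
    ∃ C : ℝ, 0 < C ∧ ∀ u : ℝ, |1 + u| ^ q ≤ 1 + q * u + C * (u ^ 2 + |u| ^ q) := by
  refine ⟨q ^ 2 + (q + 1) ^ q, by positivity, fun u => ?_⟩
  have hu : 0 ≤ |u| ^ q := by positivity
  have hC : 0 ≤ (q + 1) ^ q := by positivity
  -- For small `q u`, `(1 + u)^q ≤ e^{qu} ≤ 1 + qu + (qu)²`. For large `q u`, `|1 + u| ≤ (q +
  -- 1)|u|`, and `q² u²` compensates a negative `1 + q u`.
  rcases le_total (|q * u|) 1 with h | h
  · have h1 : 0 ≤ 1 + u := by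
      rw [abs_mul, abs_of_pos (by linarith)] at h
      have : |u| ≤ 1 := (le_mul_of_one_le_left (abs_nonneg u) hq).trans h
      linarith [(abs_le.1 this).1]
    have h2 : |1 + u| ^ q ≤ Real.exp (q * u) := by
      rw [abs_of_nonneg h1, mul_comm, Real.exp_mul]
      gcongr
      linarith [Real.add_one_le_exp u]
    have h3 := (abs_le.1 (Real.abs_exp_sub_one_sub_id_le h)).2
    nlinarith [mul_nonneg hC (sq_nonneg u), mul_nonneg (sq_nonneg q) hu, mul_nonneg hC hu]
  · have h1 : |1 + u| ≤ (q + 1) * |u| := by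
      rw [abs_mul, abs_of_pos (by linarith)] at h
      have := abs_add_le 1 u
      rw [abs_one] at this
      linarith
    have h2 : |1 + u| ^ q ≤ (q + 1) ^ q * |u| ^ q := by
      rw [← Real.mul_rpow (by positivity) (abs_nonneg u)]
      gcongr
    nlinarith [mul_nonneg hC (sq_nonneg u), mul_nonneg (sq_nonneg q) hu, sq_nonneg (q * u + 1),
      sq_nonneg (q * u)]

/-- For `s ≤ 1` the term `s²` dominates and `x^{2/q} ≤ x` suffices; for `s ≥ 1` the term `s^q`
dominates and the power `2/q` brings it back to `s²`. -/
theorem rpow_one_add_mul_le {C q s : ℝ} (hC : 0 ≤ C) (hq : 2 ≤ q) (hs : 0 ≤ s) :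
    (1 + C * (s ^ 2 + s ^ q)) ^ (2 / q) ≤ 1 + (1 + 2 * C) * s ^ 2 := by
  have hq0 : 0 < q := by linarith
  have he : 2 / q ≤ 1 := (div_le_one hq0).2 hq
  have hexp : ∀ x : ℝ, 1 ≤ x → x ^ (2 / q) ≤ x := fun x hx => by
    simpa using Real.rpow_le_rpow_of_exponent_le hx he
  rcases le_total s 1 with h | h
  · have h1 : s ^ q ≤ s ^ 2 := by
      rw [← Real.rpow_natCast]
      exact Real.rpow_le_rpow_of_exponent_ge' hs h (by norm_num) (by exact_mod_cast hq)
    have h2 : 0 ≤ s ^ q := by positivity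
    refine (hexp _ (le_add_of_nonneg_right (by positivity))).trans ?_
    nlinarith [sq_nonneg s]
  · have h1 : s ^ 2 ≤ s ^ q := by
      rw [← Real.rpow_natCast]
      exact Real.rpow_le_rpow_of_exponent_le h (by exact_mod_cast hq)
    have h2 : 1 ≤ s ^ q := Real.one_le_rpow h hq0.le
    calc (1 + C * (s ^ 2 + s ^ q)) ^ (2 / q) ≤ ((1 + 2 * C) * s ^ q) ^ (2 / q) := by
          gcongr
          nlinarith
      _ = (1 + 2 * C) ^ (2 / q) * s ^ 2 := by
        rw [Real.mul_rpow (by positivity) (by positivity), ← Real.rpow_mul hs,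
          mul_div_cancel₀ _ hq0.ne']
        norm_num
      _ ≤ (1 + 2 * C) * s ^ 2 := by
        gcongr
        exact hexp _ (by linarith)
      _ ≤ 1 + (1 + 2 * C) * s ^ 2 := by linarith

theorem eLpNorm_one_add_sq_le {X : Type*} [MeasurableSpace X] {μ : Measure X}
    [IsProbabilityMeasure μ] {q C : ℝ} (hq : 2 ≤ q) (hC : 0 ≤ C)
    (hCle : ∀ u : ℝ, |1 + u| ^ q ≤ 1 + q * u + C * (u ^ 2 + |u| ^ q)) {u : X → ℝ}
    (huq : MemLp u (ENNReal.ofReal q) μ) (hu0 : ∫ x, u x ∂μ = 0) :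
    eLpNorm (fun x => 1 + u x) (ENNReal.ofReal q) μ ^ 2 ≤
      ENNReal.ofReal (1 + (1 + 2 * C) * (eLpNorm u (ENNReal.ofReal q) μ).toReal ^ 2) := by
  have hq0 : 0 < q := by linarith
  have hqne : ENNReal.ofReal q ≠ 0 := by simpa using hq0
  have h2q : 2 ≤ ENNReal.ofReal q := by simpa using ENNReal.ofReal_le_ofReal hq
  have hu2 : MemLp u 2 μ := huq.mono_exponent h2q
  have hu1 : Integrable u μ := hu2.integrable one_le_two
  have hint : Integrable (fun x => |u x| ^ q) μ := by
    have := huq.integrable_norm_rpow hqne (by simp)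
    rwa [ENNReal.toReal_ofReal hq0.le] at this
  have hvq : MemLp (fun x => 1 + u x) (ENNReal.ofReal q) μ :=
    (memLp_const (1 : ℝ)).add huq
  have hintv : Integrable (fun x => |1 + u x| ^ q) μ := by
    have := hvq.integrable_norm_rpow hqne (by simp)
    rwa [ENNReal.toReal_ofReal hq0.le] at this
  set s := (eLpNorm u (ENNReal.ofReal q) μ).toReal with hs
  have hs0 : 0 ≤ s := ENNReal.toReal_nonneg
  have hsq : ∫ x, |u x| ^ q ∂μ = s ^ q := by
    have h0 : 0 ≤ ∫ x, |u x| ^ q ∂μ := integral_nonneg fun x => by positivity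
    rw [hs, huq.eLpNorm_eq_integral_rpow_norm hqne (by simp), ENNReal.toReal_ofReal hq0.le,
      ENNReal.toReal_ofReal (by positivity)]
    simp only [Real.norm_eq_abs]
    rw [← Real.rpow_mul h0, inv_mul_cancel₀ hq0.ne', Real.rpow_one]
  have hs2 : ∫ x, u x ^ 2 ∂μ ≤ s ^ 2 := by
    have h1 : eLpNorm u 2 μ ≤ eLpNorm u (ENNReal.ofReal q) μ :=
      eLpNorm_le_eLpNorm_of_exponent_le h2q hu2.1
    have h2 := ENNReal.toReal_mono huq.2.ne h1
    have h0 : 0 ≤ ∫ x, u x ^ 2 ∂μ := integral_nonneg fun x => by positivity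
    rw [hu2.eLpNorm_eq_integral_rpow_norm (by norm_num) (by norm_num),
      ENNReal.toReal_ofReal (by positivity)] at h2
    simp only [ENNReal.toReal_ofNat, Real.norm_eq_abs, Real.rpow_two, sq_abs] at h2
    calc ∫ x, u x ^ 2 ∂μ = ((∫ x, u x ^ 2 ∂μ) ^ (2⁻¹ : ℝ)) ^ 2 := by
          rw [← Real.rpow_natCast, ← Real.rpow_mul h0]; norm_num
      _ ≤ s ^ 2 := by gcongr
  have hI : ∫ x, |1 + u x| ^ q ∂μ ≤ 1 + C * (s ^ 2 + s ^ q) := by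
    have hR1 : Integrable (fun x => 1 + q * u x) μ :=
      (integrable_const (1 : ℝ)).add (hu1.const_mul q)
    have hR2 : Integrable (fun x => u x ^ 2 + |u x| ^ q) μ := hu2.integrable_sq.add hint
    refine (integral_mono hintv (hR1.add (hR2.const_mul C)) fun x => hCle (u x)).trans ?_
    simp only [Pi.add_apply]
    rw [integral_add hR1 (hR2.const_mul C), integral_add (integrable_const _) (hu1.const_mul q),
      integral_const_mul, integral_const_mul, integral_add hu2.integrable_sq hint, hu0, hsq]
    simp only [integral_const, probReal_univ, smul_eq_mul, mul_one, mul_zero, add_zero]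
    gcongr
  have h0 : 0 ≤ ∫ x, |1 + u x| ^ q ∂μ := integral_nonneg fun x => by positivity
  rw [hvq.eLpNorm_eq_integral_rpow_norm hqne (by simp), ENNReal.toReal_ofReal hq0.le,
    ← ENNReal.ofReal_pow (by positivity)]
  refine ENNReal.ofReal_le_ofReal (le_trans ?_ (rpow_one_add_mul_le hC hq hs0))
  simp only [Real.norm_eq_abs]
  rw [← Real.rpow_natCast, ← Real.rpow_mul h0, div_eq_inv_mul]
  push_cast
  gcongr

/-- If `g` is centred, then `‖x + g‖_q² ≤ x² + C ‖g‖_q²` for a constant depending on `q` only. -/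
theorem exists_eLpNorm_const_add_sq_le {q : ℝ} (hq : 2 ≤ q) :
    ∃ C : ℝ, 0 < C ∧ ∀ {X : Type*} [MeasurableSpace X] {μ : Measure X} [IsProbabilityMeasure μ]
      (g : X → ℝ), AEStronglyMeasurable g μ → ∫ x, g x ∂μ = 0 → ∀ c : ℝ,
      eLpNorm (fun x => c + g x) (ENNReal.ofReal q) μ ^ 2 ≤
        ENNReal.ofReal (c ^ 2) + ENNReal.ofReal C * eLpNorm g (ENNReal.ofReal q) μ ^ 2 := by
  obtain ⟨C, hC, hCle⟩ := exists_abs_one_add_rpow_le (q := q) (by linarith)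
  have hq0 : 0 < q := by linarith
  refine ⟨1 + 2 * C, by positivity, fun {X} _ {μ} _ g hgm hg0 c => ?_⟩
  rcases eq_or_ne (eLpNorm g (ENNReal.ofReal q) μ) ∞ with htop | htop
  · have h : ENNReal.ofReal (1 + 2 * C) ≠ 0 := by
      rw [Ne, ENNReal.ofReal_eq_zero, not_le]; positivity
    simp [htop, ENNReal.mul_top h]
  rcases eq_or_ne c 0 with rfl | hc
  · simp only [zero_add]
    refine le_add_left (le_mul_of_one_le_left' ?_)
    rw [← ENNReal.ofReal_one]
    exact ENNReal.ofReal_le_ofReal (by linarith)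
  have hqne : ENNReal.ofReal q ≠ 0 := by simpa using hq0
  have hgq : MemLp g (ENNReal.ofReal q) μ := ⟨hgm, htop.lt_top⟩
  set u : X → ℝ := fun x => c⁻¹ * g x with hu
  have huq : MemLp u (ENNReal.ofReal q) μ := hgq.const_mul c⁻¹
  have hu0 : ∫ x, u x ∂μ = 0 := by rw [hu, integral_const_mul, hg0, mul_zero]
  have hv := eLpNorm_one_add_sq_le hq hC.le hCle huq hu0
  set s := (eLpNorm u (ENNReal.ofReal q) μ).toReal with hs
  have hs0 : 0 ≤ s := ENNReal.toReal_nonneg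
  have hscale : ∀ w : X → ℝ, eLpNorm (fun x => c * w x) (ENNReal.ofReal q) μ ^ 2 =
      ENNReal.ofReal (c ^ 2) * eLpNorm w (ENNReal.ofReal q) μ ^ 2 := fun w => by
    have := eLpNorm_const_smul c w (ENNReal.ofReal q) μ
    rw [← sq_abs c, ENNReal.ofReal_pow (abs_nonneg c), ← mul_pow, ← Real.norm_eq_abs,
      ofReal_norm, ← this]
    rfl
  have h1 : (fun x => c + g x) = fun x => c * (1 + u x) := by
    funext x; rw [hu]; field_simp
  have h2 : g = fun x => c * u x := by
    funext x; rw [hu]; field_simp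
  rw [h1, hscale]
  conv_rhs => rw [h2, hscale]
  have h3 : eLpNorm u (ENNReal.ofReal q) μ = ENNReal.ofReal s := (ENNReal.ofReal_toReal huq.2.ne).symm
  rw [h3, ← ENNReal.ofReal_pow hs0]
  calc ENNReal.ofReal (c ^ 2) * eLpNorm (fun x => 1 + u x) (ENNReal.ofReal q) μ ^ 2
      ≤ ENNReal.ofReal (c ^ 2) * ENNReal.ofReal (1 + (1 + 2 * C) * s ^ 2) := by gcongr
    _ = _ := by
      rw [ENNReal.ofReal_add zero_le_one (by positivity), ENNReal.ofReal_one,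
        ENNReal.ofReal_mul (p := 1 + 2 * C) (by positivity)]
      ring

theorem Lp.norm_sub_const_integral_sq {X : Type*} [MeasurableSpace X] {μ : Measure X}
    [IsProbabilityMeasure μ] (f : Lp ℝ 2 μ) :
    ‖f - Lp.const 2 μ (∫ x, f x ∂μ)‖ ^ 2 = variance (f : X → ℝ) μ := by
  have h : ‖Lp.const 2 μ (∫ x, f x ∂μ)‖ ^ 2 = (∫ x, f x ∂μ) ^ 2 := by
    rw [← real_inner_self_eq_norm_sq, L2.inner_const,
      integral_congr_ae (Lp.coeFn_const (μ := μ) 2 _)]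
    simp [sq]
  rw [norm_sub_sq_real, L2.inner_const, h, variance_Lp_eq]
  ring

/-! ### The tight Sobolev inequality -/

theorem mainTheorem3 {X : Type*} [MeasurableSpace X] (μ : Measure X) [IsProbabilityMeasure μ]
    (P : SymmetricMarkovSemigroup μ) (hP : P.SatisfiesPoincare)
    (H : ℕ → Submodule ℝ (Lp ℝ 2 μ))
    (hH : IsHilbertSum ℝ (fun k => H k) (fun k => (H k).subtypeₗᵢ))
    (a C p : ℝ) (ha : 0 < a)
    (hbound : ∀ (k : ℕ) (f : Lp ℝ 2 μ), f ∈ H k → ∀ t : ℝ, 0 < t →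
      eLpNorm (P.op t f : X → ℝ) ∞ μ ≤
        ENNReal.ofReal (C * (max (k : ℝ) 1) ^ p * Real.exp (-a * t * (k : ℝ) ^ 2) * ‖f‖)) :
    ∀ m : ℝ, 2 < m → 2 * p + 1 ≤ m → P.SatisfiesTightSobolev m := by
  intro m hm hpm
  obtain ⟨c, hc, hpoinc⟩ := hP
  obtain ⟨K, hK, hKle⟩ := P.exists_norm_op_sq_le H hH ha hbound (by linarith) hpm
  obtain ⟨A, hA, hsob⟩ := P.exists_eLpNorm_sq_le hm (K := K * 2 ^ (m / 2)) (by positivity)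
    fun t ht ht1 g => P.norm_sq_le_of_norm_op_sq_le hKle ht ht1 g
  have hm2 : 0 < m - 2 := by linarith
  obtain ⟨B, hB, htight⟩ := exists_eLpNorm_const_add_sq_le (q := 2 * m / (m - 2))
    (by rw [le_div_iff₀ hm2]; linarith)
  -- `A (c + 1) e` bounds `A (‖g‖² + e)` for the centred part `g`, by the Poincaré inequality and
  -- because subtracting a constant leaves the energies unchanged.
  refine ⟨hm, B * (A * (c + 1)), by positivity, fun f e he => ?_⟩
  set b := ∫ x, f x ∂μ with hb
  set g := f - Lp.const 2 μ b with hg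
  have hvar := P.variance_le_of_hasEnergy hc hpoinc he
  have hgsq : ‖g‖ ^ 2 ≤ c * e := (Lp.norm_sub_const_integral_sq f).trans_le hvar
  have hcoe : g =ᵐ[μ] fun x => f x - b := by
    filter_upwards [Lp.coeFn_sub f (Lp.const 2 μ b), Lp.coeFn_const (μ := μ) 2 b] with x h1 h2
    rw [hg, h1, Pi.sub_apply, h2, Function.const_apply]
  have hg0 : ∫ x, g x ∂μ = 0 := by
    rw [integral_congr_ae hcoe, integral_sub ((Lp.memLp f).integrable (by norm_num))
      (integrable_const b), ← hb]
    simp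
  have hgs := hsob g e fun t ht => by
    rw [hg, P.approxEnergy_sub_const ht.le]
    exact he.approxEnergy_le ht
  have hfg : (f : X → ℝ) =ᵐ[μ] fun x => b + g x := by
    filter_upwards [hcoe] with x hx
    rw [hx]; ring
  have hb2 : b ^ 2 ≤ ‖f‖ ^ 2 := by
    have := variance_nonneg (f : X → ℝ) μ
    rw [variance_Lp_eq] at this
    linarith
  have he0 := he.nonneg
  rw [eLpNorm_congr_ae hfg]
  calc _ ≤ _ := htight g (Lp.aestronglyMeasurable g) hg0 b
    _ ≤ ENNReal.ofReal (b ^ 2) + ENNReal.ofReal B * ENNReal.ofReal (A * (‖g‖ ^ 2 + e)) := by gcongr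
    _ = ENNReal.ofReal (b ^ 2 + B * (A * (‖g‖ ^ 2 + e))) := by
      rw [← ENNReal.ofReal_mul hB.le, ENNReal.ofReal_add (by positivity) (by positivity)]
    _ ≤ ENNReal.ofReal (1 * ‖f‖ ^ 2 + B * (A * (c + 1)) * e) := by
      refine ENNReal.ofReal_le_ofReal ?_
      have h1 : B * (A * (‖g‖ ^ 2 + e)) ≤ B * (A * (c * e + e)) := by gcongr
      linarith
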